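/- **Corollary (G-dependence logic $\equiv \Sigma^1_1$).** *Teams.* Fix a countably infinite set $\mathrm{Var}$ of individual variables. A team with values in a set $M$ and domain $D\subseteq\mathrm{Var}$ is a pair $X=(I,\tau)$ with $I$ a set and $\tau:I\to M^{D}$ a function; write $x(s)$ for $\tau(s)(x)$. For finite $x,y\subseteq D$, the team $X$ satisfies the G-dependence atom ${\Bumpeq}(x,y)$ if for all $s,s'\in I$: if there is exactly one $x_i\in x$ with $x_i(s)\neq x_i(s')$, then there is at least one $y_j\in y$ with $y_j(s)\ne y_j(s')$. *G-dependence logic.* Let $L$ be a vocabulary (relation and function symbols of finite arities, of any cardinality). Formulas of G-dependence logic over $L$ are built from atomic $L$-formulas and their negations (identities $t=t'$ and negated identities $t\neq t'$ included) and G-dependence atoms by $\wedge,\vee,\exists x,\forall x$; a sentence is a formula without free variables. For an $L$-structure $\mathcal M$ with universe $M$ and a team $X=(I,\tau)$ with values in $M$ whose domain contains the free variables of $\phi$, define $\mathcal M\models_X\phi$ by: * for $\phi$ a G-dependence atom: $X$ satisfies $\phi$ as above; * for $\phi$ a literal: $\mathcal M\models_{\tau(i)}\phi$ in the first-order sense for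 every $i\in I$; * $\mathcal M\models_X\psi\wedge\theta$ iff $\mathcal M\models_X\psi$ and $\mathcal M\models_X\theta$; * $\mathcal M\models_X\psi\vee\theta$ iff there are $J,K\subseteq I$ with $J\cup K=I$, $\mathcal M\models_{(J,\tau\restriction J)}\psi$ and $\mathcal M\models_{(K,\tau\restriction K)}\theta$; * $\mathcal M\models_X\exists x\,\psi$ iff there is $F:I\to M$ such that $\mathcal M\models_{(I,\tau')}\psi$, where $\tau'(i)$ sends $x$ to $F(i)$ and agrees with $\tau(i)$ on $D\setminus\{x\}$; * $\mathcal M\models_X\forall x\,\psi$ iff $\mathcal M\models_{(I\times M,\tau')}\psi$, where $\tau'(i,a)$ sends $x$ to $a$ and agrees with $\tau(i)$ on $D\setminus\{x\}$. For a sentence $\phi$, $\mathcal M\models\phi$ means $\mathcal M\models_X\phi$ for the team $X$ with empty domain and a single row, the empty assignment. *$\Sigma^1_1$.* A $\Sigma^1_1$ sentence over $L$ is a sentence $\exists X_1\cdots\exists X_k\,\psi$, where $X_1,\dots,X_k$ are relation or function variables of finite arities and $\psi$ is a first-order sentence in the symbols of $L$ and $X_1,\dots,X_k$. It is true in $\mathcal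 M$ if $\psi$ is true for some interpretation of $X_1,\dots,X_k$ by relations and functions on $M$. **Statement.** Let $L$ be any vocabulary. For every G-dependence logic sentence $\phi$ over $L$ there is a $\Sigma^1_1$ sentence $\Phi$ over $L$ such that for every $L$-structure $\mathcal M$ with non-empty universe $$\mathcal M\models\phi\iff\mathcal M\models\Phi .$$ Conversely, for every $\Sigma^1_1$ sentence $\Phi$ over $L$ there is a G-dependence logic sentence $\phi$ over $L$ such that the same equivalence holds for every $L$-structure $\mathcal M$ with non-empty universe. -/

import Mathlib

universe u v w

namespace GDependence

/-- Formulas of G-dependence logic over the vocabulary `L`, with `ℕ` as the countable set `Var` of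
individual variables. `GFormula L D` consists of the formulas whose free variables all lie in the
finite set `D` of variables, so they can be evaluated on teams with domain `D`. The formula
`∃ x φ` has its free variables in `D` iff those of `φ` lie in `insert x D`, and the same for
`∀ x φ`; the bound variable `x` may already be in `D` (it is then reused). -/
inductive GFormula (L : FirstOrder.Language.{u, v}) : Finset ℕ → Type (max u v)
  /-- The identity atom `t₁ = t₂`. -/
  | equal {D : Finset ℕ} (t₁ t₂ : L.Term D) : GFormula L D
  /-- The negated identity atom `t₁ ≠ t₂`. -/
  | notEqual {D : Finset ℕ} (t₁ t₂ : L.Term D) : GFormula L D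
  /-- The atomic formula `R(t₀, …)`. -/
  | rel {D : Finset ℕ} {n : ℕ} (R : L.Relations n) (ts : Fin n → L.Term D) : GFormula L D
  /-- The negated atomic formula `¬ R(t₀, …)`. -/
  | notRel {D : Finset ℕ} {n : ℕ} (R : L.Relations n) (ts : Fin n → L.Term D) : GFormula L D
  /-- The G-dependence atom saying that the finite set `y` of variables G-depends on `x`. -/
  | gdep {D : Finset ℕ} (x y : Finset D) : GFormula L D
  | and {D : Finset ℕ} (φ ψ : GFormula L D) : GFormula L D
  | or {D : Finset ℕ} (φ ψ : GFormula L D) : GFormula L D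
  | ex {D : Finset ℕ} (x : ℕ) (φ : GFormula L (insert x D)) : GFormula L D
  | all {D : Finset ℕ} (x : ℕ) (φ : GFormula L (insert x D)) : GFormula L D

/-- The assignment on `D ∪ {x}` that sends `x` to `a` and agrees with `s` on `D \ {x}`. -/
def updateRow {M : Type w} {D : Finset ℕ} (s : D → M) (x : ℕ) (a : M) :
    ↥(insert x D) → M :=
  fun y => if h : y.1 = x then a else s ⟨y.1, Finset.mem_of_mem_insert_of_ne y.2 h⟩

/-- `y` G-depends on `x` in the team `(I, τ)` with domain `D`: whenever two rows differ at exactly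
one variable of `x`, they differ at some variable of `y`. -/
def GDepends {M : Type w} {D : Finset ℕ} {I : Type w} (τ : I → D → M) (x y : Finset D) : Prop :=
  ∀ s s' : I, (∃! a, a ∈ x ∧ τ s a ≠ τ s' a) → ∃ b ∈ y, τ s b ≠ τ s' b

/-- Team semantics: satisfaction of a formula by the team `(I, τ)` with domain `D` and values in
the `L`-structure `M`. The same assignment may occur at several indices. -/
def GFormula.Sat {L : FirstOrder.Language.{u, v}} {M : Type w} [L.Structure M] :
    {D : Finset ℕ} → GFormula L D → {I : Type w} → (I → D → M) → Prop
  | _, .equal t₁ t₂, I, τ => ∀ i : I, t₁.realize (τ i) = t₂.realize (τ i)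
  | _, .notEqual t₁ t₂, I, τ => ∀ i : I, t₁.realize (τ i) ≠ t₂.realize (τ i)
  | _, .rel R ts, I, τ => ∀ i : I, FirstOrder.Language.Structure.RelMap R fun k => (ts k).realize (τ i)
  | _, .notRel R ts, I, τ => ∀ i : I, ¬ FirstOrder.Language.Structure.RelMap R fun k => (ts k).realize (τ i)
  | _, .gdep x y, _, τ => GDepends τ x y
  | _, .and φ ψ, _, τ => φ.Sat τ ∧ ψ.Sat τ
  | _, .or φ ψ, I, τ => ∃ J K : Set I, J ∪ K = Set.univ ∧
      φ.Sat (fun j : J => τ j) ∧ ψ.Sat (fun k : K => τ k)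
  | _, .ex x φ, I, τ => ∃ F : I → M, φ.Sat fun i : I => updateRow (τ i) x (F i)
  | _, .all x φ, I, τ => φ.Sat fun p : I × M => updateRow (τ p.1) x p.2

/-- Sentences of G-dependence logic: formulas without free variables. -/
abbrev GSentence (L : FirstOrder.Language.{u, v}) : Type (max u v) := GFormula L ∅

/-- Truth of a sentence in `M`: satisfaction by the team with empty domain that has one row, the
empty assignment. -/
def GSentence.Holds {L : FirstOrder.Language.{u, v}} (φ : GSentence L) (M : Type w) [L.Structure M] : Prop :=
  φ.Sat (M := M) (I := PUnit) fun _ y => absurd y.2 (Finset.notMem_empty y.1)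

/-- Existential second-order sentences `∃ X₁ … ∃ Xₖ ψ` over `L`. The second-order variables
`X₁, …, Xₖ` are the finitely many relation and function symbols (of any arities) of a
vocabulary `vars`, and `ψ` is a first-order sentence in the symbols of `L` and these variables. -/
structure SigmaOneOne (L : FirstOrder.Language.{u, v}) where
  /-- The existentially quantified relation and function variables. -/
  vars : FirstOrder.Language.{0, 0}
  finite_vars : Finite vars.Symbols
  /-- The first-order matrix. -/
  matrix : (L.sum vars).Sentence

/-- Truth of `∃ X₁ … ∃ Xₖ ψ` in `M` under the full second-order semantics: some interpretation of
the second-order variables by relations and functions on `M` makes `ψ` true. -/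
def SigmaOneOne.Holds {L : FirstOrder.Language.{u, v}} (Φ : SigmaOneOne L) (M : Type w) [L.Structure M] :
    Prop :=
  ∃ _ : Φ.vars.Structure M, FirstOrder.Language.Sentence.Realize M Φ.matrix

end GDependence

/-! From G-dependence logic to $\Sigma^1_1$: a team met while evaluating a sentence can be indexed
by a subset `P` of some $M^k$, its rows given by a map `τ`. By induction on the formula,
satisfaction is an existential second-order property of `P` and `τ`
(`GFormula.isExistentialSO_satOn`). Literals and atoms are first-order conditions on at most two
rows, a disjunction guesses two $k$-ary relations, an existential quantifier guesses a $k$-ary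
function, and a universal quantifier raises $k$ by one.

Conversely, a G-dependence atom with a single variable on the left is ordinary functional dependence
(`gDepends_singleton_image`). Hence $\forall \bar x\,\exists \bar y$ followed by such atoms and a
quantifier-free formula says that functions exist, each depending on a prescribed set of the $\bar
x$, which make the matrix true for all $\bar x$ (`isGDefinable_exists_dependsOn_forall`). Relations
are coded as equalities between function values (`isGDefinable_exists_dependsOn_forall_bool`).

It remains to bring $\exists \bar X\,\psi$ to a form where every function or relation has one fixed
argument tuple. For this, the values of terms, the truth of subformulas and Skolem functions are
quantified too, with quantifier-free axioms (`formAx`) describing their recursion. A second-order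
variable of $\psi$ is applied to a separate stock of "right" variables, and its axioms are
conditional on these being equal to the required arguments. The true values satisfy the axioms
(`intended_formAx`), and the axioms force the true values (`realize_iff_of_valid`). -/

namespace GDependence

open FirstOrder FirstOrder.Language

/-! ### Reindexing, empty teams and one-row teams. -/

section

variable {L : FirstOrder.Language.{u, v}} {M : Type w} [L.Structure M]

/-- Team semantics is preserved by reindexing along an arbitrary map; in particular it is downward
closed and depends on the index set only up to bijection. -/
theorem GFormula.Sat.comp {D : Finset ℕ} {φ : GFormula L D} {I : Type w} {τ : I → D → M}
    (h : φ.Sat τ) {I' : Type w} (e : I' → I) : φ.Sat fun i => τ (e i) := by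
  induction φ generalizing I I' with
  | equal | notEqual | rel | notRel => exact fun i => h (e i)
  | gdep x y => exact fun s s' => h (e s) (e s')
  | and φ ψ ihφ ihψ => exact ⟨ihφ h.1 e, ihψ h.2 e⟩
  | or φ ψ ihφ ihψ =>
    obtain ⟨J, K, hJK, hJ, hK⟩ := h
    refine ⟨e ⁻¹' J, e ⁻¹' K, by rw [← Set.preimage_union, hJK, Set.preimage_univ], ?_, ?_⟩
    · exact ihφ hJ fun j : e ⁻¹' J => (⟨e j, j.2⟩ : J)
    · exact ihψ hK fun k : e ⁻¹' K => (⟨e k, k.2⟩ : K)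
  | ex x φ ih =>
    obtain ⟨F, hF⟩ := h
    exact ⟨fun i => F (e i), ih hF e⟩
  | all x φ ih => exact ih h fun p : I' × M => (e p.1, p.2)

theorem GFormula.sat_equiv {D : Finset ℕ} {φ : GFormula L D} {I I' : Type w} (e : I' ≃ I)
    {τ : I → D → M} : (φ.Sat fun i => τ (e i)) ↔ φ.Sat τ :=
  ⟨fun h => by simpa using h.comp e.symm, fun h => h.comp e⟩

theorem GFormula.sat_of_isEmpty {D : Finset ℕ} (φ : GFormula L D) {I : Type w} [IsEmpty I]
    (τ : I → D → M) : φ.Sat τ := by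
  induction φ generalizing I with
  | equal | notEqual | rel | notRel => exact fun i => isEmptyElim i
  | gdep x y => exact fun s => isEmptyElim s
  | and φ ψ ihφ ihψ => exact ⟨ihφ _, ihψ _⟩
  | or φ ψ ihφ ihψ => exact ⟨∅, ∅, Set.eq_univ_of_forall fun i => isEmptyElim i, ihφ _, ihψ _⟩
  | ex x φ ih => exact ⟨fun i => isEmptyElim i, ih _⟩
  | all x φ ih => exact ih _

theorem GFormula.sat_and {D : Finset ℕ} {φ ψ : GFormula L D} {I : Type w} {τ : I → D → M} :
    (φ.and ψ).Sat τ ↔ φ.Sat τ ∧ ψ.Sat τ := Iff.rfl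

/-- A single row lies in one of the two parts, and the empty team satisfies everything. Disjunctions
of sentences are therefore classical. -/
theorem GFormula.sat_or_of_subsingleton {D : Finset ℕ} {φ ψ : GFormula L D} {I : Type w}
    [Subsingleton I] {τ : I → D → M} : (φ.or ψ).Sat τ ↔ φ.Sat τ ∨ ψ.Sat τ := by
  constructor
  · rintro ⟨J, K, hJK, hJ, hK⟩
    rcases isEmpty_or_nonempty I with hI | ⟨⟨i⟩⟩
    · exact .inl (φ.sat_of_isEmpty τ)
    have hi : i ∈ J ∪ K := hJK ▸ Set.mem_univ i
    refine hi.imp (fun h => ?_) fun h => ?_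
    · exact hJ.comp fun j : I => (⟨j, Subsingleton.elim i j ▸ h⟩ : J)
    · exact hK.comp fun j : I => (⟨j, Subsingleton.elim i j ▸ h⟩ : K)
  · rintro (h | h)
    · exact ⟨Set.univ, ∅, Set.union_empty _, h.comp _, sat_of_isEmpty _ _⟩
    · exact ⟨∅, Set.univ, Set.empty_union _, sat_of_isEmpty _ _, h.comp _⟩

end

/-! ### From G-dependence logic to existential second-order logic. -/

section

/-- A property `Q` of a subset `P` of `M^k` and a function `τ` from `M^k` to assignments on `D` is
existential second-order: there are a finite vocabulary `W` and a property `H` of its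
interpretations such that `Q` says that some interpretation has `H`, and `H` is expressed by a
first-order sentence in every vocabulary in which `P` and `τ` are given by a formula and terms. -/
def IsExistentialSO {L : FirstOrder.Language.{u, v}} {k : ℕ} {D : Finset ℕ}
    (Q : ∀ (M : Type w) [L.Structure M], Set (Fin k → M) → ((Fin k → M) → D → M) → Prop) : Prop :=
  ∃ W : FirstOrder.Language.{0, 0}, Finite W.Symbols ∧
    ∃ H : ∀ (M : Type w) [L.Structure M], W.Structure M → Set (Fin k → M) →
        ((Fin k → M) → D → M) → Prop,
      (∀ (M : Type w) [Nonempty M] [L.Structure M] P τ, Q M P τ ↔ ∃ S, H M S P τ) ∧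
      ∀ (L' : FirstOrder.Language.{u, v}) (i : L →ᴸ L') (j : W →ᴸ L') (P : L'.Formula (Fin k))
        (t : D → L'.Term (Fin k)), ∃ χ : L'.Sentence, ∀ (M : Type w) [L'.Structure M],
          Sentence.Realize M χ ↔ @H M (i.reduct M) (j.reduct M) {a | P.Realize a}
            (fun a d => (t d).realize a)

/-- Satisfaction by the team with index set `P`. -/
def GFormula.SatOn {L : FirstOrder.Language.{u, v}} {D : Finset ℕ} (φ : GFormula L D) {k : ℕ}
    (M : Type w) [L.Structure M] (P : Set (Fin k → M)) (τ : (Fin k → M) → D → M) : Prop :=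
  φ.Sat fun a : P => τ a

theorem _root_.FirstOrder.Language.finite_symbols_sum {L₁ L₂ : FirstOrder.Language.{0, 0}}
    (h₁ : Finite L₁.Symbols) (h₂ : Finite L₂.Symbols) : Finite (L₁.sum L₂).Symbols := by
  have h₁' : L₁.card < Cardinal.aleph0 := Cardinal.lt_aleph0_iff_finite.2 h₁
  have h₂' : L₂.card < Cardinal.aleph0 := Cardinal.lt_aleph0_iff_finite.2 h₂
  refine Cardinal.lt_aleph0_iff_finite.1 ?_
  change (L₁.sum L₂).card < _
  rw [card_sum]
  simpa using Cardinal.add_lt_aleph0 h₁' h₂'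

section

variable {L : FirstOrder.Language.{u, v}} {k : ℕ} {D : Finset ℕ}

theorem IsExistentialSO.congr
    {Q Q' : ∀ (M : Type w) [L.Structure M], Set (Fin k → M) → ((Fin k → M) → D → M) → Prop}
    (h : IsExistentialSO Q)
    (hQ : ∀ (M : Type w) [Nonempty M] [L.Structure M] P τ, Q' M P τ ↔ Q M P τ) :
    IsExistentialSO Q' := by
  obtain ⟨W, f, H, q, c⟩ := h
  exact ⟨W, f, H, fun M _ _ P τ => (hQ M P τ).trans (q M P τ), c⟩

/-- Covers literals and G-dependence atoms alike: the terms `t` are substituted into `θ` for two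
independent row indices, with no second-order variable. -/
theorem IsExistentialSO.of_pairs (θ : L.Formula (D ⊕ D)) :
    IsExistentialSO.{u, v, w} (L := L) (k := k) (D := D) fun _ _ P τ =>
      ∀ a ∈ P, ∀ b ∈ P, θ.Realize (Sum.elim (τ a) (τ b)) := by
  refine ⟨Language.empty, inferInstance, fun _ _ _ P τ =>
    ∀ a ∈ P, ∀ b ∈ P, θ.Realize (Sum.elim (τ a) (τ b)), fun M _ _ P τ =>
      ⟨fun h => ⟨Language.emptyStructure, h⟩, fun ⟨_, h⟩ => h⟩, fun L' i j P t => ?_⟩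
  let ψ : L'.Formula (Fin k ⊕ Fin k) :=
    (P.relabel Sum.inl).imp ((P.relabel Sum.inr).imp ((i.onFormula θ).subst
      (Sum.elim (fun d => (t d).relabel Sum.inl) fun d => (t d).relabel Sum.inr)))
  refine ⟨(ψ.relabel Sum.inr : L'.Formula (Empty ⊕ _)).iAlls _, fun M _ => ?_⟩
  let := i.reduct M
  have key : ∀ c : Fin k ⊕ Fin k → M, ψ.Realize c ↔ (P.Realize (c ∘ Sum.inl) →
      P.Realize (c ∘ Sum.inr) → θ.Realize (Sum.elim (fun d => (t d).realize (c ∘ Sum.inl))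
        fun d => (t d).realize (c ∘ Sum.inr))) := by
    intro c
    have h1 : (fun a => ((Sum.elim (fun d => (t d).relabel Sum.inl)
        fun d => (t d).relabel Sum.inr : D ⊕ D → L'.Term (Fin k ⊕ Fin k)) a).realize c) =
        Sum.elim (fun d => (t d).realize (c ∘ Sum.inl)) fun d => (t d).realize (c ∘ Sum.inr) := by
      ext (d | d) <;> simp
    simp only [ψ, Formula.realize_imp, Formula.realize_relabel]
    rw [← LHom.realize_onFormula i θ, ← h1]
    exact imp_congr Iff.rfl (imp_congr Iff.rfl BoundedFormula.realize_subst)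
  simp only [Sentence.Realize, Formula.realize_iAlls, Formula.realize_relabel]
  constructor
  · intro h a ha b hb
    exact (key _).1 (h (Sum.elim a b)) ha hb
  · intro h c
    exact (key _).2 fun h1 h2 => h _ h1 _ h2

theorem IsExistentialSO.of_forall (θ : L.Formula D) :
    IsExistentialSO.{u, v, w} (L := L) (k := k) (D := D) fun _ _ P τ =>
      ∀ a ∈ P, θ.Realize (τ a) := by
  refine (of_pairs (θ.relabel Sum.inl)).congr fun M _ _ P τ => ?_
  simp only [Formula.realize_relabel, Sum.elim_comp_inl]
  exact ⟨fun h a ha _ _ => h a ha, fun h a ha => h a ha a ha⟩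

/-- Finiteness of `x` and `y` turns both quantifiers over variables into finite disjunctions and
conjunctions. -/
theorem exists_formula_gdepends (x y : Finset D) :
    ∃ θ : L.Formula (D ⊕ D), ∀ (M : Type w) [L.Structure M] (s s' : D → M),
      θ.Realize (Sum.elim s s') ↔ ((∃! a, a ∈ x ∧ s a ≠ s' a) → ∃ b ∈ y, s b ≠ s' b) := by
  classical
  let eq (d : D) : L.Formula (D ⊕ D) := (Term.var (Sum.inl d)).equal (Term.var (Sum.inr d))
  refine ⟨(Formula.iSup fun a : x => (eq a).not ⊓ Formula.iInf fun b : x =>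
    if b = a then ⊤ else eq b).imp (Formula.iSup fun b : y => (eq b).not), fun M _ s s' => ?_⟩
  have heq (d : D) : (eq d).Realize (Sum.elim s s') ↔ s d = s' d := by simp [eq]
  have hite (a b : x) : (if b = a then ⊤ else eq b : L.Formula (D ⊕ D)).Realize (Sum.elim s s') ↔
      (s b ≠ s' b → b = a) := by
    split_ifs with h
    · simp [h]
    · simp [h, heq]
  simp only [Formula.realize_imp, Formula.realize_iSup, Formula.realize_inf, Formula.realize_not,
    Formula.realize_iInf, heq, hite]
  refine imp_congr ?_ (by simp)
  simp only [Subtype.exists, ExistsUnique, Subtype.forall, Subtype.mk.injEq, exists_prop,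
    and_assoc, and_imp]

theorem IsExistentialSO.and
    {Q₁ Q₂ : ∀ (M : Type w) [L.Structure M], Set (Fin k → M) → ((Fin k → M) → D → M) → Prop}
    (h₁ : IsExistentialSO Q₁) (h₂ : IsExistentialSO Q₂) :
    IsExistentialSO.{u, v, w} (L := L) (k := k) fun M _ P τ => Q₁ M P τ ∧ Q₂ M P τ := by
  obtain ⟨W₁, f₁, H₁, q₁, c₁⟩ := h₁
  obtain ⟨W₂, f₂, H₂, q₂, c₂⟩ := h₂
  refine ⟨W₁.sum W₂, finite_symbols_sum f₁ f₂, fun M _ S P τ =>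
    H₁ M (@LHom.reduct _ _ LHom.sumInl M S) P τ ∧ H₂ M (@LHom.reduct _ _ LHom.sumInr M S) P τ,
    fun M _ _ P τ => ?_, fun L' i j P t => ?_⟩
  · simp only [q₁, q₂]
    exact ⟨fun ⟨⟨S₁, h₁⟩, S₂, h₂⟩ => ⟨sumStructure _ _ _, h₁, h₂⟩,
      fun ⟨S, h₁, h₂⟩ => ⟨⟨_, h₁⟩, _, h₂⟩⟩
  · obtain ⟨χ₁, h₁⟩ := c₁ L' i (j.comp LHom.sumInl) P t
    obtain ⟨χ₂, h₂⟩ := c₂ L' i (j.comp LHom.sumInr) P t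
    refine ⟨χ₁ ⊓ χ₂, fun M _ => ?_⟩
    exact Formula.realize_inf.trans (and_congr (h₁ M) (h₂ M))

/-- The vocabulary of two `k`-ary relation symbols. -/
def pairLang (k : ℕ) : FirstOrder.Language.{0, 0} := ⟨fun _ => Empty, fun n => {_b : Bool // n = k}⟩

/-- The vocabulary of one `k`-ary function symbol. -/
def funLang (k : ℕ) : FirstOrder.Language.{0, 0} := ⟨fun n => PLift (n = k), fun _ => Empty⟩

theorem finite_symbols_pairLang : Finite (pairLang k).Symbols := by
  refine Finite.of_injective (β := Bool) (fun s => s.elim (fun f => f.2.elim) fun r => r.2.1) ?_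
  rintro (⟨_, ⟨⟩⟩ | ⟨n, b, hn⟩) (⟨_, ⟨⟩⟩ | ⟨n', b', hn'⟩) h
  subst hn hn'
  cases h
  rfl

theorem finite_symbols_funLang : Finite (funLang k).Symbols := by
  refine Finite.of_injective (β := Unit) (fun _ => ()) ?_
  rintro (⟨n, ⟨hn⟩⟩ | ⟨_, ⟨⟩⟩) (⟨n', ⟨hn'⟩⟩ | ⟨_, ⟨⟩⟩) h
  subst hn hn'
  rfl

/-- The interpretation of `pairLang k` by two given relations. -/
@[reducible] def pairStructure {M : Type w} (J : Bool → Set (Fin k → M)) : (pairLang k).Structure M where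
  funMap f := f.elim
  RelMap r a := a ∘ Fin.cast r.2.symm ∈ J r.1

/-- The interpretation of `funLang k` by a given function. -/
@[reducible] def funStructure {M : Type w} (F : (Fin k → M) → M) : (funLang k).Structure M where
  funMap f a := F (a ∘ Fin.cast f.down.symm)
  RelMap r := r.elim

/-- The two parts of the team are guessed as relations `r`. The sentences for the disjuncts come
from replacing `P` by `P ⊓ r b`, which is why `IsExistentialSO` allows an arbitrary formula for `P`.
-/
theorem IsExistentialSO.or
    {Q₁ Q₂ : ∀ (M : Type w) [L.Structure M], Set (Fin k → M) → ((Fin k → M) → D → M) → Prop}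
    (h₁ : IsExistentialSO Q₁) (h₂ : IsExistentialSO Q₂) :
    IsExistentialSO.{u, v, w} (L := L) (k := k) fun M _ P τ => ∃ J : Bool → Set (Fin k → M), P ⊆ J true ∪ J false ∧
      Q₁ M (P ∩ J true) τ ∧ Q₂ M (P ∩ J false) τ := by
  obtain ⟨W₁, f₁, H₁, q₁, c₁⟩ := h₁
  obtain ⟨W₂, f₂, H₂, q₂, c₂⟩ := h₂
  let J {M : Type w} (S : ((W₁.sum W₂).sum (pairLang k)).Structure M) (b : Bool) :
    Set (Fin k → M) := {a | S.RelMap (Sum.inr ⟨b, rfl⟩) a}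
  refine ⟨(W₁.sum W₂).sum (pairLang k),
    finite_symbols_sum (finite_symbols_sum f₁ f₂) finite_symbols_pairLang, fun M _ S P τ =>
    P ⊆ J S true ∪ J S false ∧
    H₁ M (@LHom.reduct _ _ (LHom.sumInl.comp LHom.sumInl) M S) (P ∩ J S true) τ ∧
    H₂ M (@LHom.reduct _ _ (LHom.sumInl.comp LHom.sumInr) M S) (P ∩ J S false) τ,
    fun M _ _ P τ => ?_, fun L' i j P t => ?_⟩
  · simp only [q₁, q₂]
    constructor
    · rintro ⟨J, hJ, ⟨S₁, h₁⟩, S₂, h₂⟩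
      let := pairStructure J
      exact ⟨sumStructure _ _ _, hJ, h₁, h₂⟩
    · rintro ⟨S, hJ, h₁, h₂⟩
      exact ⟨J S, hJ, ⟨_, h₁⟩, _, h₂⟩
  · let r (b : Bool) : L'.Formula (Fin k) :=
      (j.onRelation (Sum.inr ⟨b, rfl⟩ : ((W₁.sum W₂).sum (pairLang k)).Relations k)).formula
        Term.var
    obtain ⟨χ₁, h₁⟩ := c₁ L' i (j.comp (LHom.sumInl.comp LHom.sumInl)) (P ⊓ r true) t
    obtain ⟨χ₂, h₂⟩ := c₂ L' i (j.comp (LHom.sumInl.comp LHom.sumInr)) (P ⊓ r false) t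
    refine ⟨((P.imp (r true ⊔ r false)).relabel Sum.inr : L'.Formula (Empty ⊕ _)).iAlls _ ⊓
      (χ₁ ⊓ χ₂), fun M _ => ?_⟩
    have hr (b : Bool) : {a : Fin k → M | (P ⊓ r b).Realize a} =
        {a | P.Realize a} ∩ J (j.reduct M) b := by
      ext a
      simp [r, J, LHom.reduct]
    refine Formula.realize_inf.trans (and_congr ?_ (Formula.realize_inf.trans
      (and_congr ((h₁ M).trans ?_) ((h₂ M).trans ?_))))
    · simp only [Formula.realize_iAlls, Formula.realize_relabel, Formula.realize_imp,
        Formula.realize_sup, r, Formula.realize_rel]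
      rfl
    · rw [hr]; rfl
    · rw [hr]; rfl

/-- The guessed function becomes a symbol applied to the row index, and this is the term for the
variable `x`. -/
theorem IsExistentialSO.ex {x : ℕ}
    {Q : ∀ (M : Type w) [L.Structure M], Set (Fin k → M) →
      ((Fin k → M) → ↥(insert x D) → M) → Prop} (h : IsExistentialSO Q) :
    IsExistentialSO.{u, v, w} (L := L) (k := k) fun M _ P τ => ∃ F : (Fin k → M) → M,
      Q M P fun a => updateRow (τ a) x (F a) := by
  obtain ⟨W, f, H, q, c⟩ := h
  refine ⟨W.sum (funLang k), finite_symbols_sum f finite_symbols_funLang, fun M _ S P τ =>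
    H M (@LHom.reduct _ _ LHom.sumInl M S) P fun a =>
      updateRow (τ a) x (S.funMap (Sum.inr ⟨rfl⟩) a), fun M _ _ P τ => ?_, fun L' i j P t => ?_⟩
  · simp only [q]
    constructor
    · rintro ⟨F, S, h⟩
      let := funStructure F
      exact ⟨sumStructure _ _ _, h⟩
    · rintro ⟨S, h⟩
      exact ⟨_, _, h⟩
  · obtain ⟨χ, h⟩ := c L' i (j.comp LHom.sumInl) P fun y => if h : y.1 = x then
      .func (j.onFunction (Sum.inr ⟨rfl⟩ : (W.sum (funLang k)).Functions k)) Term.var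
      else t ⟨y.1, Finset.mem_of_mem_insert_of_ne y.2 h⟩
    refine ⟨χ, fun M _ => (h M).trans (iff_of_eq ?_)⟩
    congr 1
    ext a y
    by_cases hy : y.1 = x
    · simp only [hy, updateRow, dif_pos]; rfl
    · simp only [hy, updateRow]; rfl

/-- The new value is stored as the last coordinate of the row index; formula and terms are pulled
back along `Fin.castSucc`. -/
theorem IsExistentialSO.all {x : ℕ}
    {Q : ∀ (M : Type w) [L.Structure M], Set (Fin (k + 1) → M) →
      ((Fin (k + 1) → M) → ↥(insert x D) → M) → Prop} (h : IsExistentialSO Q) :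
    IsExistentialSO.{u, v, w} (L := L) (k := k) fun M _ (P : Set (Fin k → M)) τ => Q M {a | a ∘ Fin.castSucc ∈ P} fun a =>
      updateRow (τ (a ∘ Fin.castSucc)) x (a (Fin.last k)) := by
  obtain ⟨W, f, H, q, c⟩ := h
  refine ⟨W, f, fun M _ S P τ => H M S {a | a ∘ Fin.castSucc ∈ P} fun a =>
      updateRow (τ (a ∘ Fin.castSucc)) x (a (Fin.last k)), fun M _ _ P τ => q _ _ _,
    fun L' i j P t => ?_⟩
  obtain ⟨χ, h⟩ := c L' i j (P.relabel Fin.castSucc) fun y => if h : y.1 = x then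
    .var (Fin.last k) else (t ⟨y.1, Finset.mem_of_mem_insert_of_ne y.2 h⟩).relabel Fin.castSucc
  refine ⟨χ, fun M _ => (h M).trans (iff_of_eq ?_)⟩
  congr 1
  · ext a
    simp
  · ext a y
    by_cases hy : y.1 = x
    · simp [hy, updateRow]
    · simp [hy, updateRow]

theorem GFormula.satOn_or {φ ψ : GFormula L D} {M : Type w} [L.Structure M]
    {P : Set (Fin k → M)} {τ : (Fin k → M) → D → M} :
    (φ.or ψ).SatOn M P τ ↔ ∃ J : Bool → Set (Fin k → M), P ⊆ J true ∪ J false ∧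
      φ.SatOn M (P ∩ J true) τ ∧ ψ.SatOn M (P ∩ J false) τ := by
  constructor
  · rintro ⟨J, K, hJK, hJ, hK⟩
    refine ⟨fun b => Subtype.val '' (cond b J K), fun a ha => ?_, ?_, ?_⟩
    · have h : (⟨a, ha⟩ : P) ∈ J ∪ K := hJK ▸ Set.mem_univ _
      exact h.imp (fun h => ⟨_, h, rfl⟩) fun h => ⟨_, h, rfl⟩
    · refine hJ.comp fun a : ↥(P ∩ Subtype.val '' J) => (⟨⟨a.1, a.2.1⟩, ?_⟩ : J)
      obtain ⟨b, hb, hba⟩ := a.2.2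
      rwa [show b = ⟨a.1, a.2.1⟩ from Subtype.ext hba] at hb
    · refine hK.comp fun a : ↥(P ∩ Subtype.val '' K) => (⟨⟨a.1, a.2.1⟩, ?_⟩ : K)
      obtain ⟨b, hb, hba⟩ := a.2.2
      rwa [show b = ⟨a.1, a.2.1⟩ from Subtype.ext hba] at hb
  · rintro ⟨J, hJ, h₁, h₂⟩
    refine ⟨Subtype.val ⁻¹' J true, Subtype.val ⁻¹' J false,
      Set.eq_univ_of_forall fun a => hJ a.2, ?_, ?_⟩
    · exact h₁.comp fun a : ↥(Subtype.val ⁻¹' J true : Set P) =>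
        (⟨a.1.1, a.1.2, a.2⟩ : ↥(P ∩ J true))
    · exact h₂.comp fun a : ↥(Subtype.val ⁻¹' J false : Set P) =>
        (⟨a.1.1, a.1.2, a.2⟩ : ↥(P ∩ J false))

theorem GFormula.satOn_ex {x : ℕ} {φ : GFormula L (insert x D)} {M : Type w} [Nonempty M]
    [L.Structure M] {P : Set (Fin k → M)} {τ : (Fin k → M) → D → M} :
    (GFormula.ex x φ).SatOn M P τ ↔
      ∃ F : (Fin k → M) → M, φ.SatOn M P fun a => updateRow (τ a) x (F a) := by
  classical
  constructor
  · rintro ⟨F, hF⟩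
    -- The value outside `P` is immaterial, but a total function needs one; this uses that `M` is
    -- non-empty.
    refine ⟨fun a => if h : a ∈ P then F ⟨a, h⟩ else Classical.arbitrary M, ?_⟩
    unfold SatOn
    convert hF using 3 with a
    simp
  · rintro ⟨F, hF⟩
    exact ⟨fun a => F a, hF⟩

theorem GFormula.satOn_all {x : ℕ} {φ : GFormula L (insert x D)} {M : Type w}
    [L.Structure M] {P : Set (Fin k → M)} {τ : (Fin k → M) → D → M} :
    (GFormula.all x φ).SatOn M P τ ↔ φ.SatOn M {a : Fin (k + 1) → M | a ∘ Fin.castSucc ∈ P} fun a =>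
      updateRow (τ (a ∘ Fin.castSucc)) x (a (Fin.last k)) := by
  constructor
  · intro h
    exact GFormula.Sat.comp (φ := φ) h
      fun a : {a : Fin (k + 1) → M | a ∘ Fin.castSucc ∈ P} => ((⟨_, a.2⟩, a.1 (Fin.last k)) : P × M)
  · intro h
    have hs (p : P × M) : (Fin.snoc p.1.1 p.2 : Fin (k + 1) → M) ∘ Fin.castSucc = p.1.1 := by
      ext; simp
    have := GFormula.Sat.comp (φ := φ) h fun p : P × M =>
      (⟨Fin.snoc p.1.1 p.2, by rw [Set.mem_ofPred_eq, hs]; exact p.1.2⟩ :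
        {a : Fin (k + 1) → M | a ∘ Fin.castSucc ∈ P})
    simp only [hs, Fin.snoc_last] at this
    exact this

theorem GFormula.isExistentialSO_satOn (φ : GFormula L D) (k : ℕ) :
    IsExistentialSO.{u, v, w} (L := L) (k := k) fun M _ P τ => φ.SatOn M P τ := by
  induction φ generalizing k with
  | equal t₁ t₂ =>
    exact (IsExistentialSO.of_forall (t₁.equal t₂)).congr fun M _ _ P τ => by simp [SatOn, Sat]
  | notEqual t₁ t₂ =>
    exact (IsExistentialSO.of_forall (t₁.equal t₂).not).congr fun M _ _ P τ => by simp [SatOn, Sat]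
  | rel R ts =>
    exact (IsExistentialSO.of_forall (R.formula ts)).congr fun M _ _ P τ => by simp [SatOn, Sat]
  | notRel R ts =>
    exact (IsExistentialSO.of_forall (R.formula ts).not).congr fun M _ _ P τ => by simp [SatOn, Sat]
  | gdep x y =>
    obtain ⟨θ, hθ⟩ := exists_formula_gdepends.{u, v, w} (L := L) x y
    refine (IsExistentialSO.of_pairs θ).congr fun M _ _ P τ => ?_
    simp only [hθ, SatOn, Sat, GDepends, Subtype.forall]
  | and φ ψ ihφ ihψ => exact (ihφ k).and (ihψ k)
  | or φ ψ ihφ ihψ => exact ((ihφ k).or (ihψ k)).congr fun M _ _ P τ => satOn_or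
  | ex x φ ih => exact (ih k).ex.congr fun M _ _ P τ => satOn_ex
  | all x φ ih => exact (ih (k + 1)).all.congr fun M _ _ P τ => satOn_all

end

theorem exists_sigmaOneOne_iff_holds {L : FirstOrder.Language.{u, v}} (φ : GSentence L) :
    ∃ Φ : SigmaOneOne L, ∀ (M : Type w) [Nonempty M] [L.Structure M], φ.Holds M ↔ Φ.Holds M := by
  obtain ⟨W, f, H, q, c⟩ := φ.isExistentialSO_satOn.{u, v, w} 0
  obtain ⟨χ, hχ⟩ := c (L.sum W) LHom.sumInl LHom.sumInr ⊤
    fun d => absurd d.2 (Finset.notMem_empty d.1)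
  refine ⟨⟨W, f, χ⟩, fun M _ _ => ?_⟩
  -- The one-row team is indexed by all of $M^0$.
  have h0 : φ.Holds M ↔ φ.SatOn M (Set.univ : Set (Fin 0 → M)) fun _ d =>
      absurd d.2 (Finset.notMem_empty d.1) :=
    ⟨fun h => GFormula.Sat.comp (φ := φ) h fun _ => PUnit.unit,
      fun h => GFormula.Sat.comp (φ := φ) h fun _ => ⟨Fin.elim0, Set.mem_univ _⟩⟩
  refine (h0.trans (q M _ _)).trans (exists_congr fun S => ?_)
  refine ((hχ M).trans (iff_of_eq ?_)).symm
  change H M S _ _ = _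
  congr 1
  · ext a
    simp
  · ext a d
    exact absurd d.2 (Finset.notMem_empty d.1)

end

/-! ### Quantifier prefixes, functional dependence and flat formulas. -/

section

/-- The set `{0, …, k - 1}` of variables, built by successive insertion. -/
def initVars : ℕ → Finset ℕ
  | 0 => ∅
  | k + 1 => insert k (initVars k)

theorem mem_initVars {k d : ℕ} : d ∈ initVars k ↔ d < k := by
  induction k with
  | zero => simp [initVars]
  | succ k ih => rw [initVars, Finset.mem_insert, ih]; omega

/-- The `i`-th of the first `k` variables. -/
def initVar {k : ℕ} (i : Fin k) : initVars k := ⟨i, mem_initVars.2 i.2⟩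

theorem initVar_injective {k : ℕ} : Function.Injective (initVar (k := k)) :=
  fun _ _ h => Fin.ext (congrArg Subtype.val h)

/-- The assignment on the first `k` variables given by a `k`-tuple. -/
def initRow {M : Type w} {k : ℕ} (a : Fin k → M) : initVars k → M :=
  fun d => a ⟨d, mem_initVars.1 d.2⟩

/-- Since `initVars (k + 1)` is `insert k (initVars k)` by definition, quantifying variable `k`
appends an entry without any transport of domains. -/
theorem updateRow_initRow {M : Type w} {k : ℕ} (a : Fin k → M) (b : M) :
    updateRow (initRow a) k b = initRow (k := k + 1) (Fin.snoc a b : Fin (k + 1) → M) := by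
  ext ⟨d, hd⟩
  by_cases h : d = k
  · subst h
    simp [updateRow, initRow, Fin.snoc]
  · have : d < k := by have := mem_initVars (k := k + 1).1 hd; omega
    simp [updateRow, initRow, Fin.snoc, h, this]

variable {L : FirstOrder.Language.{u, v}}

/-- Universal quantification over the first `n` variables. -/
def GFormula.alls : ∀ n : ℕ, GFormula L (initVars n) → GSentence L
  | 0, φ => φ
  | n + 1, φ => alls n (.all n φ)

/-- Existential quantification over the last `m` of the first `n + m` variables. -/
def GFormula.exs (n : ℕ) : ∀ m : ℕ, GFormula L (initVars (n + m)) → GFormula L (initVars n)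
  | 0, φ => φ
  | m + 1, φ => exs n m (.ex (n + m) φ)

section

variable {M : Type w} [L.Structure M]

theorem GFormula.holds_alls {n : ℕ} {φ : GFormula L (initVars n)} :
    (φ.alls n).Holds M ↔ φ.Sat fun a : Fin n → M => initRow a := by
  induction n with
  | zero =>
    have h0 (a : Fin 0 → M) : initRow a = fun d => absurd d.2 (Finset.notMem_empty d.1) := by
      ext d
      exact absurd d.2 (Finset.notMem_empty d.1)
    simp only [h0]
    exact ⟨fun h => Sat.comp (φ := φ) h fun _ => PUnit.unit,
      fun h => Sat.comp (φ := φ) h fun _ => Fin.elim0⟩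
  | succ n ih =>
    refine ih.trans ?_
    simp only [Sat, updateRow_initRow]
    let e : (Fin n → M) × M ≃ (Fin (n + 1) → M) :=
      ⟨fun p => Fin.snoc (α := fun _ => M) p.1 p.2, fun a => (Fin.init a, a (Fin.last n)),
        fun p => by simp, fun a => by simp⟩
    exact GFormula.sat_equiv (φ := φ) e (τ := fun a : Fin (n + 1) → M => initRow a)

theorem GFormula.sat_exs {n m : ℕ} {φ : GFormula L (initVars (n + m))} {I : Type w}
    {a : I → Fin n → M} : ((φ.exs n m).Sat fun i => initRow (a i)) ↔
      ∃ F : I → Fin m → M, φ.Sat fun i => initRow (Fin.append (a i) (F i)) := by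
  induction m with
  | zero =>
    have h0 (i : I) (F : I → Fin 0 → M) : Fin.append (a i) (F i) = a i := by
      rw [Subsingleton.elim (F i) Fin.elim0, Fin.append_elim0]
      rfl
    simp only [h0]
    exact ⟨fun h => ⟨fun _ => Fin.elim0, h⟩, fun ⟨_, h⟩ => h⟩
  | succ m ih =>
    refine ih.trans ?_
    simp only [Sat, updateRow_initRow]
    constructor
    · rintro ⟨F, G, h⟩
      refine ⟨fun i => Fin.snoc (F i) (G i), ?_⟩
      simp only [Fin.append_snoc]
      exact h
    · rintro ⟨F, h⟩
      refine ⟨fun i => Fin.init (F i), fun i => F i (Fin.last m), ?_⟩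
      have h1 (i : I) : (Fin.snoc (Fin.append (a i) (Fin.init (F i))) (F i (Fin.last m)) :
          Fin (n + m + 1) → M) = Fin.append (a i) (F i) := by
        rw [← Fin.append_snoc, Fin.snoc_init_self]
      simp only [h1]
      exact h

/-- For a singleton, "exactly one variable differs" just means that it differs, and the atom is the
contrapositive of functional dependence. -/
theorem gDepends_singleton_image {k : ℕ} {I : Type w} {a : I → Fin k → M} {j : Fin k}
    {s : Finset (Fin k)} :
    GDepends (fun i => initRow (a i)) {initVar j} (s.map ⟨initVar, initVar_injective⟩) ↔
      ∀ i i', (∀ l ∈ s, a i l = a i' l) → a i j = a i' j := by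
  have h (i i') : (∃! d, d ∈ ({initVar j} : Finset (initVars k)) ∧
      initRow (a i) d ≠ initRow (a i') d) ↔ a i j ≠ a i' j := by
    simp only [Finset.mem_singleton, ExistsUnique]
    exact ⟨fun ⟨_, ⟨rfl, h⟩, _⟩ => h, fun h => ⟨_, ⟨rfl, h⟩, fun _ h => h.1⟩⟩
  simp only [GDepends, h]
  refine forall₂_congr fun i i' => ?_
  rw [← not_imp_not]
  simp [initRow, initVar]

end

/-- A property of `k`-tuples is flat if some formula holds in a team iff every row of the team has
the property. -/
def IsFlat {k : ℕ} (P : ∀ (M : Type w) [L.Structure M], (Fin k → M) → Prop) : Prop :=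
  ∃ φ : GFormula L (initVars k), ∀ (M : Type w) [L.Structure M] (I : Type w) (a : I → Fin k → M),
    (φ.Sat fun i => initRow (a i)) ↔ ∀ i, P M (a i)

namespace IsFlat

variable {k : ℕ} {P Q : ∀ (M : Type w) [L.Structure M], (Fin k → M) → Prop}

theorem congr (h : IsFlat P) (hQ : ∀ (M : Type w) [L.Structure M] a, Q M a ↔ P M a) :
    IsFlat Q := by
  obtain ⟨φ, hφ⟩ := h
  exact ⟨φ, fun M _ I a => by simp only [hφ, hQ]⟩

theorem and (hP : IsFlat P) (hQ : IsFlat Q) : IsFlat (L := L) fun M _ (a : Fin k → M) => P M a ∧ Q M a := by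
  obtain ⟨φ, hφ⟩ := hP
  obtain ⟨ψ, hψ⟩ := hQ
  exact ⟨φ.and ψ, fun M _ I a => by simp only [GFormula.sat_and, hφ, hψ, forall_and]⟩

theorem or (hP : IsFlat P) (hQ : IsFlat Q) : IsFlat (L := L) fun M _ (a : Fin k → M) => P M a ∨ Q M a := by
  obtain ⟨φ, hφ⟩ := hP
  obtain ⟨ψ, hψ⟩ := hQ
  refine ⟨φ.or ψ, fun M _ I a => ⟨?_, fun h => ?_⟩⟩
  · rintro ⟨J, K, hJK, hJ, hK⟩ i
    have hi : i ∈ J ∪ K := hJK ▸ Set.mem_univ i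
    exact hi.imp (fun hi => (hφ M J _).1 hJ ⟨i, hi⟩) fun hi => (hψ M K _).1 hK ⟨i, hi⟩
  · exact ⟨{i | P M (a i)}, {i | Q M (a i)}, Set.eq_univ_of_forall h,
      (hφ M _ _).2 fun i => i.2, (hψ M _ _).2 fun i => i.2⟩

theorem true : IsFlat (L := L) fun M _ (_ : Fin k → M) => True :=
  ⟨.gdep ∅ ∅, fun M _ I a => by simp [GFormula.Sat, GDepends, ExistsUnique]⟩

/-- A new variable is quantified because for `k = 0` there may be no term available. On the empty
team the choice function exists vacuously. -/
theorem false : IsFlat (L := L) fun M _ (_ : Fin k → M) => False :=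
  ⟨.ex k (.notEqual (.var ⟨k, Finset.mem_insert_self _ _⟩) (.var ⟨k, Finset.mem_insert_self _ _⟩)),
    fun M _ I a => by
      simp only [GFormula.Sat, ne_eq, not_true_eq_false]
      exact ⟨fun ⟨_, h⟩ i => h i, fun h => ⟨fun i => (h i).elim, h⟩⟩⟩

theorem forall_fin {n : ℕ} {P : Fin n → ∀ (M : Type w) [L.Structure M], (Fin k → M) → Prop}
    (h : ∀ i, IsFlat (P i)) : IsFlat (L := L) fun M _ (a : Fin k → M) => ∀ i, P i M a := by
  induction n with
  | zero => exact true.congr fun M _ a => by simp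
  | succ n ih =>
    exact ((h 0).and (ih fun i => h i.succ)).congr fun M _ a => by rw [Fin.forall_fin_succ]

theorem exists_fin {n : ℕ} {P : Fin n → ∀ (M : Type w) [L.Structure M], (Fin k → M) → Prop}
    (h : ∀ i, IsFlat (P i)) : IsFlat (L := L) fun M _ (a : Fin k → M) => ∃ i, P i M a := by
  induction n with
  | zero => exact false.congr fun M _ a => by simp
  | succ n ih =>
    exact ((h 0).or (ih fun i => h i.succ)).congr fun M _ a => by rw [Fin.exists_fin_succ]

end IsFlat

/-! ### Quantifier-free formulas, their finite support and their flatness. -/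

/-- Quantifier-free formulas with element variables in `α` and Boolean variables in `B`. -/
inductive QForm (L : FirstOrder.Language.{u, v}) (α B : Type*) : Type _
  | falsum : QForm L α B
  | equal (t₁ t₂ : L.Term α) : QForm L α B
  | rel {n : ℕ} (R : L.Relations n) (ts : Fin n → L.Term α) : QForm L α B
  | bool (b : B) : QForm L α B
  | imp (q₁ q₂ : QForm L α B) : QForm L α B
  | conj {n : ℕ} (q : Fin n → QForm L α B) : QForm L α B

namespace QForm

variable {α α' B B' : Type*}

/-- Truth of a quantifier-free formula under an assignment. -/
def Realize {M : Type w} [L.Structure M] (a : α → M) (t : B → Prop) : QForm L α B → Prop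
  | falsum => False
  | equal t₁ t₂ => t₁.realize a = t₂.realize a
  | rel R ts => Structure.RelMap R fun i => (ts i).realize a
  | bool b => t b
  | imp q₁ q₂ => q₁.Realize a t → q₂.Realize a t
  | conj q => ∀ i, (q i).Realize a t

/-- Renaming of element variables and substitution for Boolean variables. -/
def subst (g : α → α') (p : B → QForm L α' B') : QForm L α B → QForm L α' B'
  | falsum => falsum
  | equal t₁ t₂ => equal (t₁.relabel g) (t₂.relabel g)
  | rel R ts => rel R fun i => (ts i).relabel g
  | bool b => p b
  | imp q₁ q₂ => imp (q₁.subst g p) (q₂.subst g p)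
  | conj q => conj fun i => (q i).subst g p

/-- Biconditional. -/
def iff (q₁ q₂ : QForm L α B) : QForm L α B := conj ![imp q₁ q₂, imp q₂ q₁]

/-- Conjunction. -/
def and (q₁ q₂ : QForm L α B) : QForm L α B := conj ![q₁, q₂]

section

variable {M : Type w} [L.Structure M] {a : α → M} {t : B → Prop} {q₁ q₂ : QForm L α B}

theorem realize_subst {g : α → α'} {p : B → QForm L α' B'} {a : α' → M} {t : B' → Prop}
    (q : QForm L α B) :
    (q.subst g p).Realize a t ↔ q.Realize (a ∘ g) fun b => (p b).Realize a t := by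
  induction q with
  | falsum | bool => rfl
  | equal | rel => simp [subst, Realize]
  | imp q₁ q₂ ih₁ ih₂ => simp only [subst, Realize, ih₁, ih₂]
  | conj q ih => simp only [subst, Realize, ih]

theorem realize_iff : (q₁.iff q₂).Realize a t ↔ (q₁.Realize a t ↔ q₂.Realize a t) := by
  simp only [iff, Realize, Fin.forall_fin_two]
  exact ⟨fun h => ⟨h.1, h.2⟩, fun h => ⟨h.1, h.2⟩⟩

theorem realize_and : (q₁.and q₂).Realize a t ↔ q₁.Realize a t ∧ q₂.Realize a t := by
  simp [and, Realize, Fin.forall_fin_two]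

end

theorem _root_.FirstOrder.Language.Term.exists_finset_realize_congr (t : L.Term α) :
    ∃ s : Finset α, ∀ (M : Type w) [L.Structure M] (a a' : α → M), (∀ x ∈ s, a x = a' x) →
      t.realize a = t.realize a' := by
  classical
  induction t with
  | var x => exact ⟨{x}, fun M _ a a' h => h x (by simp)⟩
  | func f ts ih =>
    choose s hs using ih
    refine ⟨Finset.univ.biUnion s, fun M _ a a' h => ?_⟩
    simp only [Term.realize]
    congr 1
    ext i
    exact hs i M a a' fun x hx => h x (Finset.mem_biUnion.2 ⟨i, Finset.mem_univ i, hx⟩)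

/-- Finite support makes infinite sets of variables and symbols harmless: only finitely many have to
be quantified in a sentence. -/
theorem exists_finset_realize_congr (q : QForm L α B) :
    ∃ (s : Finset α) (r : Finset B), ∀ (M : Type w) [L.Structure M] (a a' : α → M)
      (t t' : B → Prop), (∀ x ∈ s, a x = a' x) → (∀ b ∈ r, t b ↔ t' b) →
      (q.Realize a t ↔ q.Realize a' t') := by
  classical
  induction q with
  | falsum => exact ⟨∅, ∅, fun M _ a a' t t' _ _ => Iff.rfl⟩
  | equal t₁ t₂ =>
    obtain ⟨s₁, h₁⟩ := t₁.exists_finset_realize_congr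
    obtain ⟨s₂, h₂⟩ := t₂.exists_finset_realize_congr
    refine ⟨s₁ ∪ s₂, ∅, fun M _ a a' t t' h _ => ?_⟩
    simp only [Realize]
    rw [h₁ M a a' fun x hx => h x (Finset.mem_union_left _ hx),
      h₂ M a a' fun x hx => h x (Finset.mem_union_right _ hx)]
  | rel R ts =>
    choose s hs using fun i => (ts i).exists_finset_realize_congr
    refine ⟨Finset.univ.biUnion s, ∅, fun M _ a a' t t' h _ => ?_⟩
    simp only [Realize]
    rw [funext fun i => hs i M a a' fun x hx =>
      h x (Finset.mem_biUnion.2 ⟨i, Finset.mem_univ i, hx⟩)]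
  | bool b => exact ⟨∅, {b}, fun M _ a a' t t' _ h => h b (by simp)⟩
  | imp q₁ q₂ ih₁ ih₂ =>
    obtain ⟨s₁, r₁, h₁⟩ := ih₁
    obtain ⟨s₂, r₂, h₂⟩ := ih₂
    refine ⟨s₁ ∪ s₂, r₁ ∪ r₂, fun M _ a a' t t' h h' => imp_congr ?_ ?_⟩
    · exact h₁ M _ _ _ _ (fun x hx => h x (Finset.mem_union_left _ hx))
        fun x hx => h' x (Finset.mem_union_left _ hx)
    · exact h₂ M _ _ _ _ (fun x hx => h x (Finset.mem_union_right _ hx))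
        fun x hx => h' x (Finset.mem_union_right _ hx)
  | conj q ih =>
    choose s r hs using ih
    refine ⟨Finset.univ.biUnion s, Finset.univ.biUnion r, fun M _ a a' t t' h h' =>
      forall_congr' fun i => ?_⟩
    exact hs i M _ _ _ _ (fun x hx => h x (Finset.mem_biUnion.2 ⟨i, Finset.mem_univ i, hx⟩))
      fun x hx => h' x (Finset.mem_biUnion.2 ⟨i, Finset.mem_univ i, hx⟩)

/-- Only literals can be negated in `GFormula`, so `q` and its negation are treated together and
negations are pushed to the leaves. -/
theorem isFlat {k : ℕ} (e : α → Fin k) (q : QForm L α Empty) :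
    IsFlat.{u, v, w} (L := L) (fun M _ (a : Fin k → M) => q.Realize (a ∘ e) Empty.elim) ∧
    IsFlat.{u, v, w} (L := L) (fun M _ (a : Fin k → M) => ¬ q.Realize (a ∘ e) Empty.elim) := by
  have hterm {M : Type w} [L.Structure M] (a : Fin k → M) (t : L.Term α) :
      (t.relabel (initVar ∘ e)).realize (initRow a) = t.realize (a ∘ e) := by
    rw [Term.realize_relabel]
    rfl
  induction q with
  | falsum =>
    exact ⟨IsFlat.false.congr fun M _ a => by simp [Realize],
      IsFlat.true.congr fun M _ a => by simp [Realize]⟩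
  | equal t₁ t₂ =>
    refine ⟨⟨.equal (t₁.relabel (initVar ∘ e)) (t₂.relabel (initVar ∘ e)), fun M _ I a => ?_⟩,
      ⟨.notEqual (t₁.relabel (initVar ∘ e)) (t₂.relabel (initVar ∘ e)), fun M _ I a => ?_⟩⟩ <;>
    simp only [GFormula.Sat, hterm, Realize, ne_eq]
  | rel R ts =>
    refine ⟨⟨.rel R fun i => (ts i).relabel (initVar ∘ e), fun M _ I a => ?_⟩,
      ⟨.notRel R fun i => (ts i).relabel (initVar ∘ e), fun M _ I a => ?_⟩⟩ <;>
    simp only [GFormula.Sat, hterm, Realize]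
  | bool b => exact b.elim
  | imp q₁ q₂ ih₁ ih₂ =>
    exact ⟨(ih₁.2.or ih₂.1).congr fun M _ a => by simp only [Realize, imp_iff_not_or],
      (ih₁.1.and ih₂.2).congr fun M _ a => by simp only [Realize, Classical.not_imp]⟩
  | conj q ih =>
    exact ⟨(IsFlat.forall_fin fun i => (ih i).1).congr fun M _ a => Iff.rfl,
      (IsFlat.exists_fin fun i => (ih i).2).congr fun M _ a => by simp only [Realize, not_forall]⟩

end QForm

end

/-! ### Defining the existence of functions with prescribed dependencies. -/

section

variable {L : FirstOrder.Language.{u, v}}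

/-- A property of non-empty structures is definable if it is expressed by a sentence of
G-dependence logic. -/
def IsGDefinable (Q : ∀ (M : Type w) [L.Structure M], Prop) : Prop :=
  ∃ φ : GSentence L, ∀ (M : Type w) [Nonempty M] [L.Structure M], φ.Holds M ↔ Q M

namespace IsGDefinable

theorem congr {P Q : ∀ (M : Type w) [L.Structure M], Prop} (h : IsGDefinable P)
    (hQ : ∀ (M : Type w) [Nonempty M] [L.Structure M], Q M ↔ P M) : IsGDefinable Q := by
  obtain ⟨φ, hφ⟩ := h
  exact ⟨φ, fun M _ _ => (hφ M).trans (hQ M).symm⟩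

theorem false : IsGDefinable.{u, v, w} (L := L) fun _ _ => False := by
  obtain ⟨φ, hφ⟩ := IsFlat.false.{u, v, w} (L := L) (k := 0)
  exact ⟨φ.alls 0, fun M _ _ => by rw [GFormula.holds_alls, hφ, forall_const]⟩

theorem or {P Q : ∀ (M : Type w) [L.Structure M], Prop} (hP : IsGDefinable P)
    (hQ : IsGDefinable Q) : IsGDefinable (L := L) fun M _ => P M ∨ Q M := by
  obtain ⟨φ, hφ⟩ := hP
  obtain ⟨ψ, hψ⟩ := hQ
  refine ⟨φ.or ψ, fun M _ _ => ?_⟩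
  exact GFormula.sat_or_of_subsingleton.trans (or_congr (hφ M) (hψ M))

theorem exists_mem {ι : Type*} {P : ι → ∀ (M : Type w) [L.Structure M], Prop} (s : Finset ι)
    (h : ∀ i, IsGDefinable (P i)) : IsGDefinable (L := L) fun M _ => ∃ i ∈ s, P i M := by
  classical
  induction s using Finset.induction_on with
  | empty => exact false.congr fun M _ _ => by simp
  | insert i s _ ih => exact ((h i).or ih).congr fun M _ _ => Finset.exists_mem_insert ..

end IsGDefinable

theorem _root_.Finset.exists_fin_leftInvOn {V : Type*} [Nonempty V] (s : Finset V) :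
    ∃ (n : ℕ) (e : V → Fin n) (r : Fin n → V), ∀ x ∈ s, r (e x) = x := by
  classical
  refine ⟨s.card + 1, fun x => if h : x ∈ s then (s.equivFin ⟨x, h⟩).castSucc else Fin.last _,
    Fin.lastCases (Classical.arbitrary V) fun i => s.equivFin.symm i, fun x hx => ?_⟩
  simp [hx]

/-- The universal prefix produces the team of all tuples, the existential prefix chooses functions
of the whole tuple, and the atoms cut each one down to its allowed arguments. The variables that
matter are first coded into `Fin n` and `Fin m`. -/
theorem isGDefinable_exists_dependsOn_forall {V Z : Type*} [Nonempty V] [Nonempty Z]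
    (A : Z → Finset V) (q : QForm L (V ⊕ Z) Empty) :
    IsGDefinable.{u, v, w} (L := L) fun M _ => ∃ F : Z → (V → M) → M,
      (∀ z, DependsOn (F z) (A z)) ∧
        ∀ a : V → M, q.Realize (Sum.elim a fun z => F z a) Empty.elim := by
  classical
  obtain ⟨s, _, hs⟩ := q.exists_finset_realize_congr
  let sZ : Finset Z := s.toRight
  obtain ⟨m, eZ, rZ, hZ⟩ := sZ.exists_fin_leftInvOn
  obtain ⟨n, eV, rV, hV⟩ := (s.toLeft ∪ sZ.biUnion A).exists_fin_leftInvOn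
  let e : V ⊕ Z → Fin (n + m) := Sum.elim (Fin.castAdd m ∘ eV) (Fin.natAdd n ∘ eZ)
  obtain ⟨θ, hθ⟩ : IsFlat.{u, v, w} (L := L) fun M _ (a : Fin (n + m) → M) =>
      q.Realize (a ∘ e) Empty.elim := (q.isFlat e).1
  let C (j : Fin m) : Finset (Fin n) := (A (rZ j)).image eV
  have hconj : ∃ δ : GFormula L (initVars (n + m)), ∀ (M : Type w) [L.Structure M] (I : Type w)
      (a : I → Fin (n + m) → M), (δ.Sat fun i => initRow (a i)) ↔
        ∀ j : Fin m, ∀ i i', (∀ l ∈ C j, a i (Fin.castAdd m l) = a i' (Fin.castAdd m l)) →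
          a i (Fin.natAdd n j) = a i' (Fin.natAdd n j) := by
    suffices h : ∀ t : Finset (Fin m), ∃ δ : GFormula L (initVars (n + m)),
        ∀ (M : Type w) [L.Structure M] (I : Type w)
        (a : I → Fin (n + m) → M), (δ.Sat fun i => initRow (a i)) ↔
          ∀ j ∈ t, ∀ i i', (∀ l ∈ C j, a i (Fin.castAdd m l) = a i' (Fin.castAdd m l)) →
            a i (Fin.natAdd n j) = a i' (Fin.natAdd n j) by
      simpa using h Finset.univ
    intro t
    induction t using Finset.induction_on with
    | empty => exact ⟨.gdep ∅ ∅, fun M _ I a => by simp [GFormula.Sat, GDepends, ExistsUnique]⟩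
    | insert j t _ ih =>
      obtain ⟨δ, hδ⟩ := ih
      refine ⟨.and (.gdep {initVar (Fin.natAdd n j)}
        (((C j).map (Fin.castAddEmb m)).map ⟨initVar, initVar_injective⟩)) δ, fun M _ I a => ?_⟩
      rw [GFormula.sat_and, hδ, Finset.forall_mem_insert]
      refine and_congr ?_ Iff.rfl
      simp only [GFormula.Sat]
      rw [gDepends_singleton_image]
      simp
  obtain ⟨δ, hδ⟩ := hconj
  refine ⟨((GFormula.and δ θ).exs n m).alls n, fun M _ _ => ?_⟩
  rw [GFormula.holds_alls, GFormula.sat_exs]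
  simp only [GFormula.sat_and, hδ, hθ, Fin.append_left, Fin.append_right]
  constructor
  · rintro ⟨F, hF, hq⟩
    -- Functions not occurring in `q` are made constant.
    refine ⟨fun z a => if z ∈ sZ then F (a ∘ rV) (eZ z) else Classical.arbitrary M,
      fun z a a' h => ?_, fun a => (hs M _ _ _ _ ?_ ?_).1 (hq (a ∘ rV))⟩
    · by_cases hz : z ∈ sZ
      · simp only [hz, if_true]
        refine hF _ _ _ fun l hl => ?_
        simp only [C, hZ z hz, Finset.mem_image] at hl
        obtain ⟨x, hx, rfl⟩ := hl
        have hx' : rV (eV x) = x :=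
          hV x (Finset.mem_union_right _ (Finset.mem_biUnion.2 ⟨z, hz, hx⟩))
        change a (rV (eV x)) = a' (rV (eV x))
        rw [hx']
        exact h x hx
      · simp only [hz, if_false]
    · rintro (x | z) hx
      · have hx' : rV (eV x) = x := hV x (Finset.mem_union_left _ (Finset.mem_toLeft.2 hx))
        simp [e, hx']
      · have hz : z ∈ sZ := Finset.mem_toRight.2 hx
        simp [e, hz]
    · simp
  · rintro ⟨F, hF, hq⟩
    refine ⟨fun a j => F (rZ j) (a ∘ eV), fun j a a' h => hF _ fun x hx => ?_,
      fun a => (hs M _ _ _ _ ?_ ?_).1 (hq (a ∘ eV))⟩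
    · exact h _ (Finset.mem_image_of_mem _ hx)
    · rintro (x | z) hx
      · simp [e]
      · have hz : rZ (eZ z) = z := hZ z (Finset.mem_toRight.2 hx)
        simp [e, hz]
    · simp

/-- A relation is coded by a function's being equal to a constant. In a one-element structure such
equalities always hold, so a finite disjunction over `r` chooses for each relation whether equality
is read as true or as false. -/
theorem isGDefinable_exists_dependsOn_forall_bool {V Y B : Type*} [Nonempty V]
    (A : Y → Finset V) (C : B → Finset V) (q : QForm L (V ⊕ Y) B) :
    IsGDefinable.{u, v, w} (L := L) fun M _ => ∃ (F : Y → (V → M) → M) (T : B → (V → M) → Prop),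
      (∀ y, DependsOn (F y) (A y)) ∧ (∀ b, DependsOn (T b) (C b)) ∧
        ∀ a : V → M, q.Realize (Sum.elim a fun y => F y a) fun b => T b a := by
  classical
  obtain ⟨_, s, hs⟩ := q.exists_finset_realize_congr
  -- The index `none` is the reference constant: its function depends on no variable.
  let A' : Option (Y ⊕ B) → Finset V := fun z => z.elim ∅ (Sum.elim A C)
  let lit (b : B) : QForm L (V ⊕ Option (Y ⊕ B)) Empty :=
    .equal (.var (.inr (some (.inr b)))) (.var (.inr none))
  let q' (r : Finset B) : QForm L (V ⊕ Option (Y ⊕ B)) Empty :=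
    q.subst (Sum.map id (some ∘ .inl)) fun b => if b ∈ r then lit b else .imp (lit b) .falsum
  have hq' (r : Finset B) (M : Type w) [L.Structure M] (a : V → M)
      (G : Option (Y ⊕ B) → (V → M) → M) :
      (q' r).Realize (Sum.elim a fun z => G z a) Empty.elim ↔
        q.Realize (Sum.elim a fun y => G (some (.inl y)) a) fun b =>
          (G (some (.inr b)) a = G none a ↔ b ∈ r) := by
    rw [QForm.realize_subst]
    refine iff_of_eq ?_
    congr 1
    · ext (x | y) <;> rfl
    · ext b
      split_ifs with hb <;> simp [lit, QForm.Realize, hb]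
  refine (IsGDefinable.exists_mem s.powerset fun r =>
    isGDefinable_exists_dependsOn_forall A' (q' r)).congr fun M _ _ => ?_
  simp only [hq']
  constructor
  · rintro ⟨F, T, hF, hT, hq⟩
    let c : M := Classical.arbitrary M
    -- With an element other than `c`, the function is an indicator of `T b`. With only `c`, the
    -- relation is constant and its truth value becomes the polarity `β`.
    have key (b : B) : ∃ (p : (V → M) → M) (β : Prop), DependsOn p (C b) ∧
        ∀ a, (p a = c ↔ β) ↔ T b a := by
      by_cases h : ∃ d : M, d ≠ c
      · obtain ⟨d, hd⟩ := h
        refine ⟨fun a => if T b a then c else d, True, fun a a' h => by simp [hT b h], fun a => ?_⟩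
        by_cases h : T b a <;> simp [h, hd]
      · push Not at h
        refine ⟨fun _ => c, T b fun _ => c, fun _ _ _ => rfl, fun a => ?_⟩
        rw [show a = fun _ => c from funext fun x => h _]
        simp
    choose p β hp hβ using key
    refine ⟨{b ∈ s | β b}, by simp, fun z => z.elim (fun _ => c) (Sum.elim F p), ?_, fun a => ?_⟩
    · rintro (_ | y | b)
      · exact fun _ _ _ => rfl
      · exact hF y
      · exact hp b
    · refine (hs M _ _ _ _ (fun _ _ => rfl) fun b hb => ?_).1 (hq a)
      simp [hb, hβ]
  · rintro ⟨r, -, G, hG, hq⟩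
    refine ⟨fun y => G (some (.inl y)), fun b a => (G (some (.inr b)) a = G none a ↔ b ∈ r),
      fun y => hG (some (.inl y)), fun b a a' h => ?_, hq⟩
    have h1 := hG (some (.inr b)) h
    have h2 : G none a = G none a' := hG none fun i hi => by simp [A'] at hi
    simp only [h1, h2]

end

/-! ### Second-order sentences as quantifier-free axioms with fixed argument tuples. -/

section

/-- The functions used to express an existential second-order sentence over `L` with second-order
variables `W`: the function variables, a function for the value of each term, and a Skolem function
choosing a counterexample to each universally quantified formula. -/
inductive FunSym (L : FirstOrder.Language.{u, v}) (W : FirstOrder.Language.{0, 0}) : Type (max u v)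
  | func {n : ℕ} (f : W.Functions n) : FunSym L W
  | term {j : ℕ} (t : (L.sum W).Term (Empty ⊕ Fin j)) : FunSym L W
  | skolem {j : ℕ} (χ : (L.sum W).BoundedFormula Empty (j + 1)) : FunSym L W

/-- The relations used to express an existential second-order sentence over `L` with second-order
variables `W`: the relation variables and a relation for the truth of each formula. -/
inductive RelSym (L : FirstOrder.Language.{u, v}) (W : FirstOrder.Language.{0, 0}) : Type (max u v)
  | rel {n : ℕ} (R : W.Relations n) : RelSym L W
  | form {j : ℕ} (χ : (L.sum W).BoundedFormula Empty j) : RelSym L W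

variable {L : FirstOrder.Language.{u, v}} {W : FirstOrder.Language.{0, 0}}

/-- The first `j` variables of the left copy of `ℕ`, which interpret the variables of formulas. -/
def leftVars (j : ℕ) : Finset (ℕ ⊕ ℕ) := (Finset.range j).map .inl

/-- The first `n` variables of the right copy of `ℕ`, which stand for arguments of second-order
variables. -/
def rightVars (n : ℕ) : Finset (ℕ ⊕ ℕ) := (Finset.range n).map .inr

/-- The variables to which a function is applied. -/
def FunSym.args : FunSym L W → Finset (ℕ ⊕ ℕ)
  | func (n := n) _ => rightVars n
  | term (j := j) _ => leftVars j
  | skolem (j := j) _ => leftVars j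

/-- The variables to which a relation is applied. -/
def RelSym.args : RelSym L W → Finset (ℕ ⊕ ℕ)
  | rel (n := n) _ => rightVars n
  | form (j := j) _ => leftVars j

/-- Quantifier-free formulas in which every function and relation has a fixed argument tuple. -/
abbrev AxForm (L : FirstOrder.Language.{u, v}) (W : FirstOrder.Language.{0, 0}) :=
  QForm L ((ℕ ⊕ ℕ) ⊕ FunSym L W) (RelSym L W)

/-- The value of a function at its arguments, as a term. -/
def FunSym.app (y : FunSym L W) : L.Term ((ℕ ⊕ ℕ) ⊕ FunSym L W) := .var (.inr y)

/-- The right variables are the values of the given terms. -/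
def argsEq {j n : ℕ} (ts : Fin n → (L.sum W).Term (Empty ⊕ Fin j)) : AxForm L W :=
  .conj fun i : Fin n => .equal (.var (.inl (.inr i))) (FunSym.term (ts i)).app

/-- The recursive definition of the value of a term. -/
def termAx {j : ℕ} : (L.sum W).Term (Empty ⊕ Fin j) → AxForm L W
  | .var (.inl x) => x.elim
  | .var (.inr i) => .equal (FunSym.term (.var (.inr i))).app (.var (.inl (.inl i)))
  | .func (l := l) f ts => .and (.conj fun i => termAx (ts i)) <|
      Sum.elim
        (fun g : L.Functions l => .equal (FunSym.term (.func f ts)).app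
          (.func g fun i => (FunSym.term (ts i)).app))
        -- A second-order variable is only available at the right variables, so its equation is
        -- guarded by `argsEq`.
        (fun g : W.Functions l => .imp (argsEq ts)
          (.equal (FunSym.term (.func f ts)).app (FunSym.func g).app)) f

/-- The recursive definition of the truth of a formula. -/
def formAx : ∀ {j : ℕ}, (L.sum W).BoundedFormula Empty j → AxForm L W
  | j, .falsum => .imp (.bool (.form (j := j) .falsum)) .falsum
  | _, .equal t₁ t₂ => .and (.and (termAx t₁) (termAx t₂)) <|
      .iff (.bool (.form (.equal t₁ t₂))) (.equal (FunSym.term t₁).app (FunSym.term t₂).app)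
  | _, .rel (l := l) R ts => .and (.conj fun i => termAx (ts i)) <|
      Sum.elim
        (fun r : L.Relations l => .iff (.bool (.form (.rel R ts)))
          (.rel r fun i => (FunSym.term (ts i)).app))
        (fun r : W.Relations l => .imp (argsEq ts)
          (.iff (.bool (.form (.rel R ts))) (.bool (.rel r)))) R
  | _, .imp χ₁ χ₂ => .and (.and (formAx χ₁) (formAx χ₂)) <|
      .iff (.bool (.form (.imp χ₁ χ₂))) (.imp (.bool (.form χ₁)) (.bool (.form χ₂)))
  -- The truth value of `χ.all` does not depend on left variable `j`, so the first implication
  -- ranges over all instances. The second needs only the instance at the Skolem value.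
  | j, .all χ => .and (formAx χ) <|
      .and (.imp (.bool (.form (.all χ))) (.bool (.form χ)))
        (.imp (.and (.equal (.var (.inl (.inl j))) (FunSym.skolem χ).app) (.bool (.form χ)))
          (.bool (.form (.all χ))))

section

variable {M : Type w}

/-- The values of the first `j` left variables. -/
def leftTuple (j : ℕ) (a : ℕ ⊕ ℕ → M) : Fin j → M := fun i => a (.inl i)

/-- The values of the first `n` right variables. -/
def rightTuple (n : ℕ) (a : ℕ ⊕ ℕ → M) : Fin n → M := fun i => a (.inr i)

theorem leftTuple_congr {j : ℕ} {a a' : ℕ ⊕ ℕ → M} (h : ∀ x ∈ leftVars j, a x = a' x) :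
    leftTuple j a = leftTuple j a' :=
  funext fun i => h _ (by simp [leftVars])

theorem rightTuple_congr {n : ℕ} {a a' : ℕ ⊕ ℕ → M} (h : ∀ x ∈ rightVars n, a x = a' x) :
    rightTuple n a = rightTuple n a' :=
  funext fun i => h _ (by simp [rightVars])

theorem eqOn_leftVars {j : ℕ} {a a' : ℕ ⊕ ℕ → M} (h : leftTuple j a = leftTuple j a') :
    ∀ x ∈ leftVars j, a x = a' x := by
  intro x hx
  obtain ⟨i, hi, rfl⟩ := Finset.mem_map.1 hx
  exact congrFun h ⟨i, Finset.mem_range.1 hi⟩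

theorem eqOn_rightVars {n : ℕ} {a a' : ℕ ⊕ ℕ → M} (h : rightTuple n a = rightTuple n a') :
    ∀ x ∈ rightVars n, a x = a' x := by
  intro x hx
  obtain ⟨i, hi, rfl⟩ := Finset.mem_map.1 hx
  exact congrFun h ⟨i, Finset.mem_range.1 hi⟩

theorem snoc_leftTuple {j : ℕ} (a : ℕ ⊕ ℕ → M) :
    (Fin.snoc (leftTuple j a) (a (.inl j)) : Fin (j + 1) → M) = leftTuple (j + 1) a := by
  ext i
  refine Fin.lastCases ?_ (fun i => ?_) i <;> simp [leftTuple]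

/-- The assignment with the left variables of `a` and the given values of the right variables. -/
noncomputable def withRight [Nonempty M] (a : ℕ ⊕ ℕ → M) {n : ℕ} (x : Fin n → M) : ℕ ⊕ ℕ → M :=
  Sum.elim (fun i => a (.inl i)) fun i => if h : i < n then x ⟨i, h⟩ else Classical.arbitrary M

theorem leftTuple_withRight [Nonempty M] {j n : ℕ} (a : ℕ ⊕ ℕ → M) (x : Fin n → M) :
    leftTuple j (withRight a x) = leftTuple j a := rfl

theorem rightTuple_withRight [Nonempty M] {n : ℕ} (a : ℕ ⊕ ℕ → M) (x : Fin n → M) :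
    rightTuple n (withRight a x) = x := by
  ext i
  simp [rightTuple, withRight]

variable [L.Structure M]

section

variable [W.Structure M]

/-- The intended interpretation of the relations. -/
def RelSym.interp : RelSym L W → (ℕ ⊕ ℕ → M) → Prop
  | rel (n := n) R, a => Structure.RelMap R (rightTuple n a)
  | form (j := j) χ, a => χ.Realize default (leftTuple j a)

theorem RelSym.dependsOn_interp (b : RelSym L W) :
    DependsOn (b.interp (M := M)) (b.args : Set (ℕ ⊕ ℕ)) := by
  intro a a' h
  cases b with
  | rel R => simp only [interp, rightTuple_congr h]
  | form χ => simp only [interp, leftTuple_congr h]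

variable [Nonempty M]

/-- The intended interpretation of the functions. -/
noncomputable def FunSym.interp : FunSym L W → (ℕ ⊕ ℕ → M) → M
  | func (n := n) f, a => Structure.funMap f (rightTuple n a)
  | term (j := j) t, a => t.realize (Sum.elim (default : Empty → M) (leftTuple j a))
  | skolem (j := j) χ, a =>
    Classical.epsilon fun m : M => ¬ χ.Realize default (Fin.snoc (leftTuple j a) m)

theorem FunSym.dependsOn_interp (y : FunSym L W) :
    DependsOn (y.interp (M := M)) (y.args : Set (ℕ ⊕ ℕ)) := by
  intro a a' h
  cases y with
  | func f => simp only [interp, rightTuple_congr h]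
  | term t => simp only [interp, leftTuple_congr h]
  | skolem χ => simp only [interp, leftTuple_congr h]

/-- Truth of an axiom under the intended interpretation. -/
def AxForm.Intended (q : AxForm L W) (a : ℕ ⊕ ℕ → M) : Prop :=
  q.Realize (Sum.elim a fun y => y.interp a) fun b => b.interp a

theorem realize_argsEq_intended {j n : ℕ} {ts : Fin n → (L.sum W).Term (Empty ⊕ Fin j)}
    {a : ℕ ⊕ ℕ → M} : AxForm.Intended (argsEq ts) a ↔
      rightTuple n a = fun i => (ts i).realize (Sum.elim default (leftTuple j a)) := by
  simp only [AxForm.Intended, argsEq, QForm.Realize, funext_iff]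
  rfl

theorem intended_termAx {j : ℕ} (t : (L.sum W).Term (Empty ⊕ Fin j)) (a : ℕ ⊕ ℕ → M) :
    AxForm.Intended (termAx t) a := by
  induction t with
  | var x =>
    cases x with
    | inl x => exact x.elim
    | inr i => rfl
  | func f ts ih =>
    refine QForm.realize_and.2 ⟨ih, ?_⟩
    cases f with
    | inl g => rfl
    | inr g =>
      intro h
      have h := realize_argsEq_intended.1 h
      simp only [QForm.Realize, FunSym.app, Term.realize_var, Sum.elim_inr, FunSym.interp, h]
      rfl

theorem intended_formAx {j : ℕ} (χ : (L.sum W).BoundedFormula Empty j) (a : ℕ ⊕ ℕ → M) :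
    AxForm.Intended (formAx χ) a := by
  induction χ with
  | falsum => exact id
  | equal t₁ t₂ =>
    exact QForm.realize_and.2 ⟨QForm.realize_and.2 ⟨intended_termAx t₁ a, intended_termAx t₂ a⟩,
      QForm.realize_iff.2 Iff.rfl⟩
  | rel R ts =>
    refine QForm.realize_and.2 ⟨fun i => intended_termAx (ts i) a, ?_⟩
    cases R with
    | inl r => exact QForm.realize_iff.2 Iff.rfl
    | inr r =>
      intro h
      have h := realize_argsEq_intended.1 h
      refine QForm.realize_iff.2 ?_
      simp only [QForm.Realize, RelSym.interp, h]
      rfl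
  | imp χ₁ χ₂ ih₁ ih₂ =>
    exact QForm.realize_and.2 ⟨QForm.realize_and.2 ⟨ih₁, ih₂⟩, QForm.realize_iff.2 Iff.rfl⟩
  | @all j χ ih =>
    refine QForm.realize_and.2 ⟨ih, QForm.realize_and.2 ⟨fun h => ?_, fun h => ?_⟩⟩
    · have h : ∀ m : M, χ.Realize default (Fin.snoc (leftTuple j a) m) := h
      change χ.Realize default (leftTuple (j + 1) a)
      rw [← snoc_leftTuple]
      exact h _
    · change ∀ m : M, χ.Realize default (Fin.snoc (leftTuple j a) m)
      obtain ⟨h₁, h₂⟩ := QForm.realize_and.1 h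
      have h₁ : a (.inl j) = (FunSym.skolem χ).interp a := h₁
      have h₂ : χ.Realize default (leftTuple (j + 1) a) := h₂
      -- If a counterexample exists, the Skolem value is one, yet `h₂` says that `χ` holds there.
      by_contra! hc
      rw [← snoc_leftTuple, h₁] at h₂
      exact Classical.epsilon_spec hc h₂

end

section

variable [Nonempty M] {F : FunSym L W → (ℕ ⊕ ℕ → M) → M} {T : RelSym L W → (ℕ ⊕ ℕ → M) → Prop}

/-- The interpretation of the second-order variables given by an interpretation of all functions
and relations. -/
@[reducible] noncomputable def varStructure (F : FunSym L W → (ℕ ⊕ ℕ → M) → M)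
    (T : RelSym L W → (ℕ ⊕ ℕ → M) → Prop) : W.Structure M where
  funMap f x := F (.func f) (withRight (fun _ => Classical.arbitrary M) x)
  RelMap R x := T (.rel R) (withRight (fun _ => Classical.arbitrary M) x)

/-- Truth of an axiom under all assignments. -/
def AxForm.Valid (q : AxForm L W) (F : FunSym L W → (ℕ ⊕ ℕ → M) → M)
    (T : RelSym L W → (ℕ ⊕ ℕ → M) → Prop) : Prop :=
  ∀ a, q.Realize (Sum.elim a fun y => F y a) fun b => T b a

/-- At a function variable the axiom speaks only when the right variables carry the argument values.
They can be set so, since term values depend on left variables alone. -/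
theorem realize_eq_of_valid (hF : ∀ y, DependsOn (F y) (y.args : Set (ℕ ⊕ ℕ))) {j : ℕ}
    (t : (L.sum W).Term (Empty ⊕ Fin j)) (ht : AxForm.Valid (termAx t) F T) (a : ℕ ⊕ ℕ → M) :
    letI := varStructure F T
    F (.term t) a = t.realize (Sum.elim default (leftTuple j a)) := by
  let _ := varStructure F T
  induction t generalizing a with
  | var x =>
    cases x with
    | inl x => exact x.elim
    | inr i => exact ht a
  | @func n f ts ih =>
    have hts (i a) : F (.term (ts i)) a = (ts i).realize (Sum.elim default (leftTuple j a)) :=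
      ih i (fun a => (QForm.realize_and.1 (ht a)).1 i) a
    have hf (a) := (QForm.realize_and.1 (ht a)).2
    cases f with
    | inl g =>
      refine (hf a).trans ?_
      exact congrArg (Structure.funMap g) (funext fun i => hts i a)
    | inr g =>
      let x : Fin n → M := fun i => (ts i).realize (Sum.elim default (leftTuple j a))
      have h1 : F (.term (.func (.inr g) ts)) (withRight a x) = F (.func g) (withRight a x) := by
        refine hf (withRight a x) fun i => ?_
        change withRight a x (.inr i) = F (.term (ts i)) (withRight a x)
        rw [hts, leftTuple_withRight]
        exact congrFun (rightTuple_withRight a x) i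
      refine Eq.trans (hF (.term _) (eqOn_leftVars (leftTuple_withRight a x).symm)) (h1.trans ?_)
      -- Only the first `n` right variables count, so the base assignment used in `varStructure` is
      -- irrelevant.
      refine hF (.func g) (eqOn_rightVars ?_)
      rw [rightTuple_withRight, rightTuple_withRight]

/-- Relation variables are handled by the same change of right variables. For `all`, left variable
`j` is varied while the value at `χ.all` stays fixed. -/
theorem realize_iff_of_valid (hF : ∀ y, DependsOn (F y) (y.args : Set (ℕ ⊕ ℕ)))
    (hT : ∀ b, DependsOn (T b) (b.args : Set (ℕ ⊕ ℕ))) {j : ℕ}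
    (χ : (L.sum W).BoundedFormula Empty j) (h : AxForm.Valid (formAx χ) F T) (a : ℕ ⊕ ℕ → M) :
    letI := varStructure F T
    T (.form χ) a ↔ χ.Realize default (leftTuple j a) := by
  let _ := varStructure F T
  induction χ generalizing a with
  | falsum => exact ⟨h a, False.elim⟩
  | equal t₁ t₂ =>
    have h₁ (a) := QForm.realize_and.1 (QForm.realize_and.1 (h a)).1
    refine (QForm.realize_iff.1 (QForm.realize_and.1 (h a)).2).trans ?_
    change F (.term t₁) a = F (.term t₂) a ↔ _
    rw [realize_eq_of_valid hF t₁ (fun a => (h₁ a).1), realize_eq_of_valid hF t₂ fun a => (h₁ a).2]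
    rfl
  | @rel j n R ts =>
    have hts (i a) : F (.term (ts i)) a = (ts i).realize (Sum.elim default (leftTuple j a)) :=
      realize_eq_of_valid hF (ts i) (fun a => (QForm.realize_and.1 (h a)).1 i) a
    have hR (a) := (QForm.realize_and.1 (h a)).2
    cases R with
    | inl r =>
      refine (QForm.realize_iff.1 (hR a)).trans (iff_of_eq ?_)
      exact congrArg (Structure.RelMap r) (funext fun i => hts i a)
    | inr r =>
      let x : Fin n → M := fun i => (ts i).realize (Sum.elim default (leftTuple j a))
      have h1 : T (.form (.rel (.inr r) ts)) (withRight a x) ↔ T (.rel r) (withRight a x) := by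
        refine QForm.realize_iff.1 (hR (withRight a x) fun i => ?_)
        change withRight a x (.inr i) = F (.term (ts i)) (withRight a x)
        rw [hts, leftTuple_withRight]
        exact congrFun (rightTuple_withRight a x) i
      refine (iff_of_eq (hT (.form _) (eqOn_leftVars (leftTuple_withRight a x).symm))).trans
        (h1.trans (iff_of_eq ?_))
      refine hT (.rel r) (eqOn_rightVars ?_)
      rw [rightTuple_withRight, rightTuple_withRight]
  | imp χ₁ χ₂ ih₁ ih₂ =>
    have h₁ (a) := QForm.realize_and.1 (QForm.realize_and.1 (h a)).1
    refine (QForm.realize_iff.1 (QForm.realize_and.1 (h a)).2).trans ?_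
    exact imp_congr (ih₁ (fun a => (h₁ a).1) a) (ih₂ (fun a => (h₁ a).2) a)
  | @all j χ ih =>
    have ih := ih fun a => (QForm.realize_and.1 (h a)).1
    have h₁ (a) := QForm.realize_and.1 (QForm.realize_and.1 (h a)).2
    have hup (m : M) : ∀ x ∈ leftVars j, Function.update a (.inl j) m x = a x := fun x hx =>
      Function.update_of_ne (by rintro rfl; simp [leftVars] at hx) _ _
    have hsnoc (m : M) : leftTuple (j + 1) (Function.update a (.inl j) m) =
        Fin.snoc (leftTuple j a) m := by
      rw [← snoc_leftTuple, leftTuple_congr (hup m), Function.update_self]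
    have hall (m : M) : T (.form χ.all) (Function.update a (.inl j) m) = T (.form χ.all) a :=
      hT (.form χ.all) (hup m)
    constructor
    · intro ha m
      rw [← hsnoc]
      exact (ih _).1 ((h₁ _).1 ((hall m).mpr ha))
    · intro ha
      -- The Skolem function does not depend on variable `j`, so setting that variable to `m` leaves
      -- its value equal to `m`.
      let m := F (.skolem χ) a
      rw [← hall m]
      refine (h₁ (Function.update a (.inl j) m)).2 (QForm.realize_and.2 ⟨?_, ?_⟩)
      · change Function.update a (.inl j) m (.inl j) = F (.skolem χ) (Function.update a (.inl j) m)
        rw [Function.update_self]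
        exact (hF (.skolem χ) (hup m)).symm
      · refine (ih (Function.update a (.inl j) m)).2 ?_
        rw [hsnoc]
        exact ha m

end

end

theorem exists_gSentence_iff_holds (Φ : SigmaOneOne L) :
    ∃ φ : GSentence L, ∀ (M : Type w) [Nonempty M] [L.Structure M], φ.Holds M ↔ Φ.Holds M := by
  refine (isGDefinable_exists_dependsOn_forall_bool FunSym.args RelSym.args
    ((formAx Φ.matrix).and (.bool (.form Φ.matrix)))).congr fun M _ _ => ⟨?_, ?_⟩
  · rintro ⟨S, hS⟩
    refine ⟨FunSym.interp, RelSym.interp, FunSym.dependsOn_interp, RelSym.dependsOn_interp,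
      fun a => QForm.realize_and.2 ⟨intended_formAx _ a, ?_⟩⟩
    change BoundedFormula.Realize Φ.matrix default (leftTuple 0 a)
    rwa [Subsingleton.elim (leftTuple 0 a) default]
  · rintro ⟨F, T, hF, hT, h⟩
    refine ⟨varStructure F T, ?_⟩
    let a : ℕ ⊕ ℕ → M := fun _ => Classical.arbitrary M
    have := (realize_iff_of_valid hF hT Φ.matrix (fun a => (QForm.realize_and.1 (h a)).1) a).1
      (QForm.realize_and.1 (h a)).2
    rwa [Subsingleton.elim (leftTuple 0 a) default] at this

end

end GDependence

theorem mainTheorem4 (L : FirstOrder.Language.{u, v}) :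
    (∀ φ : GDependence.GSentence L, ∃ Φ : GDependence.SigmaOneOne L,
      ∀ (M : Type w) [Nonempty M] [L.Structure M], φ.Holds M ↔ Φ.Holds M) ∧
    (∀ Φ : GDependence.SigmaOneOne L, ∃ φ : GDependence.GSentence L,
      ∀ (M : Type w) [Nonempty M] [L.Structure M], φ.Holds M ↔ Φ.Holds M) :=
  ⟨GDependence.exists_sigmaOneOne_iff_holds, GDependence.exists_gSentence_iff_holds⟩
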